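/- A paratopological group is a group with a topology for which multiplication is jointly continuous; it is regular if it is a $T_1$-space in which every neighbourhood of a point contains the closure of a neighbourhood of that point. A paratopological group $G$ is simply $sm$-factorizable if for every cozero set $U\subseteq G$ there is a continuous homomorphism $\pi$ of $G$ onto a separable metrizable paratopological group $H$ with $\pi^{-1}(\pi(U))=U$. For a paratopological group $G$ with topology $\tau$, the associated topological group $G^*$ is the group $G$ with the topology $\tau\vee\tau^{-1}$, where $\tau^{-1}=\{U^{-1}:U\in\tau\}$. The index of narrowness $ib(G)$ is the least cardinal $\kappa\ge\omega$ such that for every open neighbourhood $U$ of the identity there is $A\subseteq G$ with $AU=UA=G$ and $|A|\le\kappa$. Let $c(X)$ be the cellularity of a space $X$ (the supremum of the cardinalities of families of pairwise disjoint nonempty open sets, or $\omega$ if that is larger), and let $\mathfrak c=2^\omega$. For a Tychonoff space $X$, let $\upsilon X$ (the Hewitt-Nachbin realcompactification) and $\mu X$ (the Dieudonné completion) be the smallest realcompact and the smallest Dieudonné complete subspace, respectively, of the Stone-Čech compactification $\beta X$ containing $X$. Let $G$ be a regular simply $sm$-factorizable paratopological group. Then: 1. $ib(G^*)\le\mathfrak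 c$; 2. $c(G)\le c(G^*)\le 2^{\mathfrak c}$; 3. $G$ is Tychonoff, and $\mu G=\upsilon G$ as subspaces of $\beta G$; 4. there is a group operation on $\mu G$ extending that of $G$ which makes the space $\mu G$ a simply $sm$-factorizable paratopological group containing $G$ as a dense topological subgroup. -/

import Mathlib

open Set Topology Cardinal
open scoped Pointwise

universe u

/-- A cozero set: the set where some continuous real-valued function does not vanish. -/
def IsCozeroSet {X : Type u} [TopologicalSpace X] (U : Set X) : Prop :=
  ∃ f : X → ℝ, Continuous f ∧ U = {x | f x ≠ 0}

/-- A paratopological group (`ContinuousMul`: multiplication is jointly continuous) is simply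
sm-factorizable if every cozero set is the full preimage of its image under some continuous
homomorphism onto a separable metrizable paratopological group. Since `H` is an image of `G`,
nothing is lost by taking it in the universe of `G`. -/
def IsSimplySmFactorizable (G : Type u) [Group G] [TopologicalSpace G] : Prop :=
  ∀ U : Set G, IsCozeroSet U →
    ∃ (H : Type u) (_ : Group H) (_ : TopologicalSpace H) (_ : ContinuousMul H)
      (_ : TopologicalSpace.SeparableSpace H) (_ : TopologicalSpace.MetrizableSpace H)
      (p : G →* H), Continuous p ∧ Function.Surjective p ∧ p ⁻¹' (p '' U) = U

/-- The group `G*` associated to a paratopological group `G`: the same group, with the upper bound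
of the topology of `G` and the conjugate topology. -/
def AssociatedGroup (G : Type u) : Type u := G

instance AssociatedGroup.instGroup (G : Type u) [Group G] : Group (AssociatedGroup G) :=
  inferInstanceAs (Group G)

/-- The topology `τ ∨ τ⁻¹`, where `τ⁻¹ = {U⁻¹ : U ∈ τ}`. In Mathlib's order on topologies the
coarsest topology finer than both is the infimum. -/
instance AssociatedGroup.instTopologicalSpace (G : Type u) [Group G] [t : TopologicalSpace G] :
    TopologicalSpace (AssociatedGroup G) :=
  t ⊓ t.induced (fun x : G => x⁻¹)

/-- `G*` is indeed a topological group. -/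
instance AssociatedGroup.instIsTopologicalGroup (G : Type u) [Group G] [t : TopologicalSpace G]
    [ContinuousMul G] : IsTopologicalGroup (AssociatedGroup G) := by
  have h1 : @Continuous (AssociatedGroup G) G _ t (fun x => x) :=
    continuous_id_iff_le.2 inf_le_left
  have h2 : @Continuous (AssociatedGroup G) G _ t (fun x : G => x⁻¹) :=
    continuous_iff_le_induced.2 inf_le_right
  have key : ∀ {Y : Type u} [TopologicalSpace Y] (f : Y → G), @Continuous Y G _ t f →
      @Continuous Y G _ t (fun y => (f y)⁻¹) → @Continuous Y (AssociatedGroup G) _ _ f :=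
    fun {Y} _ f hf hf' => continuous_iff_coinduced_le.2
      (le_inf (continuous_iff_coinduced_le.1 hf)
        (continuous_iff_coinduced_le.1 (continuous_induced_rng.2 hf')))
  refine { continuous_mul := key _ ?_ ?_, continuous_inv := key _ h2 ?_ }
  · exact (h1.comp continuous_fst).mul (h1.comp continuous_snd)
  · exact ((h2.comp continuous_snd).mul (h2.comp continuous_fst)).congr
      fun x => (mul_inv_rev (G := G) x.1 x.2).symm
  · exact h1.congr fun x => (inv_inv (G := G) x).symm

/-- The index of narrowness `ib(G)`. -/
noncomputable def narrownessIndex (G : Type u) [Group G] [TopologicalSpace G] : Cardinal.{u} :=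
  sInf {κ | ℵ₀ ≤ κ ∧ ∀ U : Set G, IsOpen U → 1 ∈ U →
    ∃ A : Set G, A * U = Set.univ ∧ U * A = Set.univ ∧ #A ≤ κ}

/-- A cellular family: pairwise disjoint nonempty open sets. -/
def IsCellularFamily {X : Type u} [TopologicalSpace X] (F : Set (Set X)) : Prop :=
  (∀ U ∈ F, IsOpen U ∧ U.Nonempty) ∧ F.PairwiseDisjoint id

/-- The cellularity `c(X)` (infinite by convention, as all cardinal functions). -/
noncomputable def cellularity (X : Type u) [TopologicalSpace X] : Cardinal.{u} :=
  max ℵ₀ (⨆ F : {F : Set (Set X) // IsCellularFamily F}, #F.1)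

/-- A realcompact space: homeomorphic to a closed subspace of a power of the real line. -/
def IsRealcompact (X : Type u) [TopologicalSpace X] : Prop :=
  ∃ (ι : Type u) (e : X → (ι → ℝ)), IsClosedEmbedding e

/-- A Dieudonné complete space: a `T₀` (hence Tychonoff) space whose topology is induced by a
complete uniformity. -/
def IsDieudonneComplete (X : Type u) [t : TopologicalSpace X] : Prop :=
  T0Space X ∧ ∃ s : UniformSpace X, s.toTopologicalSpace = t ∧ @CompleteSpace X s

/-- The Hewitt-Nachbin realcompactification `υX` of a Tychonoff space `X`: the smallest realcompact
subspace of the Stone-Čech compactification that contains `X`. -/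
def hewittNachbin (X : Type u) [TopologicalSpace X] : Set (StoneCech X) :=
  ⋂₀ {Y | range (stoneCechUnit : X → StoneCech X) ⊆ Y ∧ IsRealcompact Y}

/-- The Dieudonné completion `μX` of a Tychonoff space `X`: the smallest Dieudonné complete
subspace of the Stone-Čech compactification that contains `X`. -/
def dieudonneCompletion (X : Type u) [TopologicalSpace X] : Set (StoneCech X) :=
  ⋂₀ {Y | range (stoneCechUnit : X → StoneCech X) ⊆ Y ∧ IsDieudonneComplete Y}

/-
A regular paratopological group is Tychonoff. Being simply `sm`-factorizable then says that every
continuous real function on `G` factors through a continuous homomorphism to a separable metrizable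
group, whose kernel we call an sm-kernel; there are at most `𝔠` cosets of such a kernel, and every
neighbourhood of the identity of `G^*` contains one. This bounds `ib(G^*)`. Disjoint cosets
`xᵢNᵢ` of sm-kernels give a colouring of pairs by `𝔠` colours without a monochromatic triangle
`a < b < c`, so an Erdős-Rado tree argument bounds `c(G^*)` by `2 ^ 𝔠`.

The space `υG` consists of the points `z` of `βG` whose zero sets trace a proper filter on `G`. This
filter is countably complete and decides every cozero set, so every continuous map from `G` to a
separable metrizable space is constant on a member of it. As `2 ^ 𝔠` is not Ulam-measurable, Stone's
disjoint families show that the filter is Cauchy for every uniformity on a space between `G` and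
`βG`; hence `μG = υG`. Being constant modulo the filter also attaches to `z` a coset of every
sm-kernel, and this identifies `υG` with the inverse limit of the groups `G ⧸ N`, which provides
the multiplication.
-/
open Filter

section CompletelyRegular

variable {G : Type u} [Group G] [TopologicalSpace G] [ContinuousMul G]

theorem closure_mul_subset_closure_mul (A V : Set G) : closure A * V ⊆ closure (A * V) := by
  rintro _ ⟨a, ha, v, hv, rfl⟩
  exact map_mem_closure (f := (· * v)) (continuous_mul_const v) ha
    fun b hb => Set.mul_mem_mul hb hv

theorem closure_subset_interior_closure_mul (A : Set G) {V : Set G} (hV : IsOpen V)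
    (h1 : (1 : G) ∈ V) : closure A ⊆ interior (closure (A * V)) :=
  (subset_mul_left _ h1).trans (interior_maximal (closure_mul_subset_closure_mul A V) hV.mul_left)

/-- The relation that `u` is a neighbourhood of the closure of `c` uniformly under right
translations, from which Urysohn functions on paratopological groups are built. -/
def IsRightThickening (c u : Set G) : Prop := ∃ W ∈ 𝓝 (1 : G), closure (c * W) ⊆ u

theorem IsRightThickening.exists_between {c u : Set G} (h : IsRightThickening c u) :
    ∃ v : Set G, IsOpen v ∧ c ⊆ v ∧ closure v ⊆ u ∧
      IsRightThickening c v ∧ IsRightThickening (closure v) u := by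
  obtain ⟨W, hW, hWu⟩ := h
  obtain ⟨V, hV, hV1, hVW⟩ := exists_open_nhds_one_mul_subset hW
  obtain ⟨V', hV', hV'1, hVV'⟩ := exists_open_nhds_one_mul_subset (hV.mem_nhds hV1)
  have hcv : closure (interior (closure (c * V))) ⊆ closure (c * V) :=
    closure_minimal interior_subset isClosed_closure
  have hthick : IsRightThickening c (interior (closure (c * V))) := by
    refine ⟨V', hV'.mem_nhds hV'1, (closure_subset_interior_closure_mul _ hV' hV'1).trans ?_⟩
    rw [mul_assoc]
    exact interior_mono (closure_mono (mul_subset_mul_left hVV'))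
  have hthick' : IsRightThickening (closure (interior (closure (c * V)))) u := by
    refine ⟨V, hV.mem_nhds hV1, (closure_minimal ?_ isClosed_closure).trans hWu⟩
    refine (mul_subset_mul_right hcv).trans ((closure_mul_subset_closure_mul _ _).trans ?_)
    rw [mul_assoc]
    exact closure_mono (mul_subset_mul_left hVW)
  have hVW' : V ⊆ W := (subset_mul_left V hV1).trans hVW
  exact ⟨interior (closure (c * V)), isOpen_interior,
    subset_closure.trans (closure_subset_interior_closure_mul c hV hV1),
    hcv.trans ((closure_mono (mul_subset_mul_left hVW')).trans hWu), hthick, hthick'⟩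

theorem isRightThickening_singleton [RegularSpace G] {x : G} {U : Set G} (hU : U ∈ 𝓝 x) :
    IsRightThickening {x} U := by
  obtain ⟨C, hC, hCc, hCU⟩ := exists_mem_nhds_isClosed_subset hU
  refine ⟨(x * ·) ⁻¹' C,
    (continuous_const_mul x).continuousAt.preimage_mem_nhds (by simpa using hC), ?_⟩
  refine (closure_minimal ?_ hCc).trans hCU
  rintro _ ⟨_, rfl, w, hw, rfl⟩
  exact hw

theorem t35Space_of_t3Space [T3Space G] : T35Space G where
  completely_regular x K hK hx := by
    let c : Urysohns.CU (IsRightThickening (G := G)) :=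
    { C := {x}
      U := Kᶜ
      closed_C := isClosed_singleton
      open_U := hK.isOpen_compl
      subset := singleton_subset_iff.2 hx
      hP := fun _ h _ _ => h.exists_between
      P_C_U := isRightThickening_singleton (hK.isOpen_compl.mem_nhds hx) }
    exact ⟨fun y => ⟨c.lim y, c.lim_mem_Icc y⟩, c.continuous_lim.subtype_mk c.lim_mem_Icc,
      Subtype.ext (c.lim_of_mem_C x rfl), fun y hy =>
        Subtype.ext (c.lim_of_notMem_U y (not_not_intro hy))⟩

end CompletelyRegular

section Cozero

theorem IsCozeroSet.preimage {X Y : Type*} [TopologicalSpace X] [TopologicalSpace Y] {U : Set Y}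
    (hU : IsCozeroSet U) {φ : X → Y} (hφ : Continuous φ) : IsCozeroSet (φ ⁻¹' U) := by
  obtain ⟨f, hf, rfl⟩ := hU
  exact ⟨f ∘ φ, hf.comp hφ, rfl⟩

theorem isCozeroSet_of_isOpen {M : Type*} [TopologicalSpace M]
    [TopologicalSpace.PseudoMetrizableSpace M] {U : Set M} (hU : IsOpen U) : IsCozeroSet U := by
  let _ := TopologicalSpace.pseudoMetrizableSpacePseudoMetric M
  rcases (Uᶜ).eq_empty_or_nonempty with h | h
  · exact ⟨1, continuous_const, by simp [compl_empty_iff.1 h]⟩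
  · refine ⟨fun x => Metric.infDist x Uᶜ, Metric.continuous_infDist_pt _, ?_⟩
    exact compl_injective (ext fun x =>
      (hU.isClosed_compl.mem_iff_infDist_zero h).trans not_not.symm)

end Cozero

section ZeroSetFilter

theorem exists_continuousMap_eq_zero_iff_forall {Y : Type*} [TopologicalSpace Y]
    (g : ℕ → C(Y, ℝ)) : ∃ h : C(Y, ℝ), ∀ y, h y = 0 ↔ ∀ n, g n y = 0 := by
  let _ := TopologicalSpace.metrizableSpaceMetric (ℕ → ℝ)
  exact ⟨⟨fun y => dist (fun n => g n y) 0, by fun_prop⟩, fun y => dist_eq_zero.trans funext_iff⟩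

variable {X : Type u} [TopologicalSpace X]

/-- The filter on `X` generated by the traces of the zero sets of `βX` through `z`. It is the
improper filter when some such zero set misses `X`. -/
def zeroSetFilter (z : StoneCech X) : Filter X :=
  Filter.ofCountableInter
    {A | ∃ g : C(StoneCech X, ℝ), g z = 0 ∧ ∀ x, g (stoneCechUnit x) = 0 → x ∈ A}
    (fun S hS hSA => by
      rcases S.eq_empty_or_nonempty with rfl | hne
      · exact ⟨0, rfl, by simp⟩
      obtain ⟨A, rfl⟩ := hS.exists_eq_range hne
      choose g hgz hgA using fun n => hSA ⟨n, rfl⟩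
      obtain ⟨h, hh⟩ := exists_continuousMap_eq_zero_iff_forall g
      refine ⟨h, (hh z).2 hgz, fun x hx => ?_⟩
      rintro _ ⟨n, rfl⟩
      exact hgA n x ((hh _).1 hx n))
    (fun _ _ ⟨g, hgz, hgA⟩ hAB => ⟨g, hgz, fun x hx => hAB (hgA x hx)⟩)

instance (z : StoneCech X) : CountableInterFilter (zeroSetFilter z) :=
  countableInter_ofCountableInter ..

theorem mem_zeroSetFilter {z : StoneCech X} {A : Set X} : A ∈ zeroSetFilter z ↔
    ∃ g : C(StoneCech X, ℝ), g z = 0 ∧ ∀ x, g (stoneCechUnit x) = 0 → x ∈ A := Iff.rfl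

theorem pure_le_zeroSetFilter (x : X) : pure x ≤ zeroSetFilter (stoneCechUnit x) :=
  fun _ ⟨_, hg, hA⟩ => hA x hg

theorem eventually_zeroSetFilter_eq {M : Type*} [TopologicalSpace M]
    [TopologicalSpace.MetrizableSpace M] {k : StoneCech X → M} (hk : Continuous k)
    (z : StoneCech X) : ∀ᶠ x in zeroSetFilter z, k (stoneCechUnit x) = k z := by
  let _ := TopologicalSpace.metrizableSpaceMetric M
  exact ⟨⟨fun y => dist (k y) (k z), by fun_prop⟩, dist_self _, fun _ => eq_of_dist_eq_zero⟩

theorem tendsto_zeroSetFilter (z : StoneCech X) :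
    Tendsto stoneCechUnit (zeroSetFilter z) (𝓝 z) := by
  refine (nhds_basis_opens z).tendsto_right_iff.2 fun U ⟨hzU, hU⟩ => ?_
  obtain ⟨f, hf, h0, h1⟩ := CompletelyRegularSpace.completely_regular_isOpen z U hU hzU
  filter_upwards [eventually_zeroSetFilter_eq hf z] with x hx
  by_contra hxU
  exact zero_ne_one ((h0.symm.trans hx.symm).trans (h1 hxU))

theorem IsCozeroSet.mem_or_compl_mem_zeroSetFilter {U : Set X} (hU : IsCozeroSet U)
    (z : StoneCech X) : U ∈ zeroSetFilter z ∨ Uᶜ ∈ zeroSetFilter z := by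
  obtain ⟨f, hf, rfl⟩ := hU
  have hp : Continuous fun x => projIcc (0 : ℝ) 1 zero_le_one |f x| := by fun_prop
  have hp0 : ∀ x, projIcc (0 : ℝ) 1 zero_le_one |f x| = 0 ↔ f x = 0 := fun x =>
    (projIcc_eq_left zero_lt_one).trans abs_nonpos_iff
  have h := eventually_zeroSetFilter_eq (continuous_stoneCechExtend hp) z
  simp only [stoneCechExtend_stoneCechUnit] at h
  by_cases hz : stoneCechExtend hp z = 0
  · exact .inr (h.mono fun x hx => not_not_intro ((hp0 x).1 (hx.trans hz)))
  · exact .inl (h.mono fun x hx hx0 => hz (hx.symm.trans ((hp0 x).2 hx0)))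

theorem exists_le_zeroSetFilter {F : Filter X} [F.NeBot]
    (hF : ∀ f : X → ℝ, Continuous f → ∃ c, ∀ᶠ x in F, f x = c) :
    ∃ z : StoneCech X, F ≤ zeroSetFilter z := by
  let 𝒰 := (Ultrafilter.of F).map (stoneCechUnit : X → StoneCech X)
  have h𝒰 : Tendsto stoneCechUnit (Ultrafilter.of F : Filter X) (𝓝 𝒰.lim) := 𝒰.le_nhds_lim
  refine ⟨𝒰.lim, fun A ⟨g, hg, hgA⟩ => ?_⟩
  obtain ⟨c, hc⟩ := hF (g ∘ stoneCechUnit) (g.continuous.comp continuous_stoneCechUnit)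
  have hgc : g 𝒰.lim = c := tendsto_nhds_unique ((g.continuous.tendsto _).comp h𝒰)
    (tendsto_const_nhds.congr' ((hc.filter_mono (Ultrafilter.of_le F)).mono fun _ hx => hx.symm))
  exact hc.mono fun x hx => hgA x (hx.trans (hgc.symm.trans hg))

end ZeroSetFilter

section RealHull

variable {X : Type u} [TopologicalSpace X]

/-- The points `z` of `βX` such that every zero set of `βX` through `z` meets `X`: the intrinsic
description of the Hewitt-Nachbin realcompactification. -/
def realHull (X : Type u) [TopologicalSpace X] : Set (StoneCech X) :=
  {z | (zeroSetFilter z).NeBot}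

instance (z : realHull X) : (zeroSetFilter (z : StoneCech X)).NeBot := z.2

theorem stoneCechUnit_mem_realHull (x : X) : stoneCechUnit x ∈ realHull X :=
  neBot_of_le (pure_le_zeroSetFilter x)

theorem range_subset_realHull : range (stoneCechUnit : X → StoneCech X) ⊆ realHull X :=
  range_subset_iff.2 stoneCechUnit_mem_realHull

/-- The canonical map from a space into its hull. -/
def hullUnit (x : X) : realHull X := ⟨stoneCechUnit x, stoneCechUnit_mem_realHull x⟩

theorem continuous_hullUnit : Continuous (hullUnit : X → realHull X) :=
  continuous_stoneCechUnit.subtype_mk _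

theorem tendsto_hullUnit (z : realHull X) :
    Tendsto hullUnit (zeroSetFilter (z : StoneCech X)) (𝓝 z) :=
  tendsto_subtype_rng.2 (tendsto_zeroSetFilter _)

theorem denseRange_hullUnit : DenseRange (hullUnit : X → realHull X) := fun z =>
  mem_closure_of_tendsto (tendsto_hullUnit z) (.of_forall mem_range_self)

variable {M : Type*} [TopologicalSpace M] [TopologicalSpace.MetrizableSpace M]
  [SecondCountableTopology M] {φ : X → M}

theorem exists_eventually_eq (hφ : Continuous φ) (z : realHull X) :
    ∃ c, ∀ᶠ x in zeroSetFilter (z : StoneCech X), φ x = c := by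
  have : Nonempty M := (nonempty_of_neBot (zeroSetFilter (z : StoneCech X))).map φ
  exact exists_eventuallyEq_const_of_forall_separating IsOpen fun U hU =>
    ((isCozeroSet_of_isOpen hU).preimage hφ).mem_or_compl_mem_zeroSetFilter z

/-- The extension of a continuous map to a separable metrizable space from `X` to its hull: the
value at `z` is the one taken on a zero set through `z`. -/
noncomputable def hullExtend (hφ : Continuous φ) (z : realHull X) : M :=
  (exists_eventually_eq hφ z).choose

theorem eventually_eq_hullExtend (hφ : Continuous φ) (z : realHull X) :
    ∀ᶠ x in zeroSetFilter (z : StoneCech X), φ x = hullExtend hφ z :=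
  (exists_eventually_eq hφ z).choose_spec

theorem hullExtend_hullUnit (hφ : Continuous φ) (x : X) : hullExtend hφ (hullUnit x) = φ x :=
  (pure_le_zeroSetFilter x (eventually_eq_hullExtend hφ (hullUnit x))).symm

theorem stoneCechExtend_comp_eq_hullExtend {K : Type*} [TopologicalSpace K]
    [TopologicalSpace.MetrizableSpace K] [CompactSpace K] {h : M → K} (hh : Continuous h)
    (hφ : Continuous φ) (z : realHull X) :
    stoneCechExtend (hh.comp hφ) z = h (hullExtend hφ z) := by
  obtain ⟨x, hx, hx'⟩ := ((eventually_zeroSetFilter_eq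
    (continuous_stoneCechExtend (hh.comp hφ)) (z : StoneCech X)).and
      (eventually_eq_hullExtend hφ z)).exists
  rw [← hx, ← hx', stoneCechExtend_stoneCechUnit, Function.comp_apply]

theorem continuous_hullExtend (hφ : Continuous φ) : Continuous (hullExtend hφ) := by
  refine continuous_iff_continuousAt.2 fun z => ?_
  refine (nhds_basis_opens _).tendsto_right_iff.2 fun U ⟨hzU, hU⟩ => ?_
  obtain ⟨h, hh, h0, h1⟩ := CompletelyRegularSpace.completely_regular_isOpen _ U hU hzU
  have hk : Continuous fun w : realHull X => stoneCechExtend (hh.comp hφ) w :=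
    (continuous_stoneCechExtend _).comp continuous_subtype_val
  have hz : stoneCechExtend (hh.comp hφ) z ≠ 1 := by
    rw [stoneCechExtend_comp_eq_hullExtend hh hφ, h0]
    exact zero_ne_one
  filter_upwards [hk.continuousAt.eventually_ne hz] with w hw
  by_contra hwU
  exact hw ((stoneCechExtend_comp_eq_hullExtend hh hφ w).trans (h1 hwU))

theorem eq_hullExtend (hφ : Continuous φ) {u : realHull X → M} (hu : Continuous u)
    (h : ∀ x, u (hullUnit x) = φ x) : u = hullExtend hφ :=
  denseRange_hullUnit.equalizer hu (continuous_hullExtend hφ)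
    (funext fun x => (h x).trans (hullExtend_hullUnit hφ x).symm)

end RealHull

section Realcompact

variable {X : Type u} [TopologicalSpace X]

theorem injective_hullExtend_eval :
    Function.Injective fun (z : realHull X) (f : C(X, ℝ)) => hullExtend f.continuous z := by
  intro z w h
  by_contra hne
  obtain ⟨k, hk, hk0, hk1⟩ := CompletelyRegularSpace.completely_regular (z : StoneCech X) {↑w}
    isClosed_singleton fun h' => hne (Subtype.ext h')
  let f : C(X, ℝ) := ⟨fun x => k (stoneCechUnit x),
    continuous_subtype_val.comp (hk.comp continuous_stoneCechUnit)⟩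
  have hf : (fun v : realHull X => (k v : ℝ)) = hullExtend f.continuous :=
    eq_hullExtend _ (continuous_subtype_val.comp (hk.comp continuous_subtype_val)) fun _ => rfl
  have hzw : hullExtend f.continuous z = hullExtend f.continuous w := congr_fun h f
  rw [← hf] at hzw
  exact zero_ne_one ((hk0.symm.trans (Subtype.ext hzw)).trans (hk1 rfl))

theorem mem_realHull_of_tendsto {F : Filter (realHull X)} [F.NeBot] {y : C(X, ℝ) → ℝ}
    (hF : ∀ f : C(X, ℝ), Tendsto (hullExtend f.continuous) F (𝓝 (y f))) {z : StoneCech X}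
    (hz : Tendsto Subtype.val F (𝓝 z)) : z ∈ realHull X := by
  by_contra hzX
  obtain ⟨g, hgz, hg⟩ := mem_zeroSetFilter.1 (empty_mem_iff_bot.2 (not_neBot.1 hzX))
  let f : C(X, ℝ) := ⟨fun x => (g (stoneCechUnit x))⁻¹,
    (g.continuous.comp continuous_stoneCechUnit).inv₀ hg⟩
  have hgf : ∀ w : realHull X, g w * hullExtend f.continuous w = 1 := fun w => by
    obtain ⟨x, hx, hx'⟩ := ((eventually_zeroSetFilter_eq g.continuous (w : StoneCech X)).and
      (eventually_eq_hullExtend f.continuous w)).exists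
    rw [← hx, ← hx']
    exact mul_inv_cancel₀ (hg x)
  have h := ((g.continuous.tendsto z).comp hz).mul (hF f)
  simp only [Function.comp_apply, hgf, hgz, zero_mul] at h
  exact one_ne_zero (tendsto_nhds_unique tendsto_const_nhds h)

theorem isClosedEmbedding_hullExtend_eval :
    IsClosedEmbedding fun (z : realHull X) (f : C(X, ℝ)) => hullExtend f.continuous z := by
  have hcont : Continuous fun (z : realHull X) (f : C(X, ℝ)) => hullExtend f.continuous z :=
    continuous_pi fun f => continuous_hullExtend f.continuous
  refine .of_continuous_injective_isClosedMap hcont injective_hullExtend_eval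
    (isProperMap_iff_ultrafilter_of_t2.2 ⟨hcont, fun 𝒰 y hy => ?_⟩).isClosedMap
  have hlim : Tendsto Subtype.val (𝒰 : Filter (realHull X)) (𝓝 (𝒰.map Subtype.val).lim) :=
    (𝒰.map Subtype.val).le_nhds_lim
  have hmem := mem_realHull_of_tendsto (tendsto_pi_nhds.1 hy) hlim
  exact ⟨⟨_, hmem⟩, tendsto_subtype_rng.2 hlim⟩

theorem isRealcompact_realHull : IsRealcompact (realHull X) :=
  ⟨C(X, ℝ), _, isClosedEmbedding_hullExtend_eval⟩

theorem mem_of_tendsto_zeroSetFilter {Y : Set (StoneCech X)}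
    (hXY : range (stoneCechUnit : X → StoneCech X) ⊆ Y) {z : realHull X} {y : Y}
    (h : Tendsto (fun x => (⟨stoneCechUnit x, hXY ⟨x, rfl⟩⟩ : Y))
      (zeroSetFilter (z : StoneCech X)) (𝓝 y)) : (z : StoneCech X) ∈ Y :=
  tendsto_nhds_unique ((continuous_subtype_val.tendsto y).comp h)
    (tendsto_zeroSetFilter (z : StoneCech X)) ▸ y.2

theorem realHull_subset_of_isRealcompact {Y : Set (StoneCech X)}
    (hXY : range (stoneCechUnit : X → StoneCech X) ⊆ Y) (hY : IsRealcompact Y) :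
    realHull X ⊆ Y := by
  obtain ⟨ι, e, he⟩ := hY
  intro z hz
  have hη : Continuous fun x => e ⟨stoneCechUnit x, hXY ⟨x, rfl⟩⟩ :=
    he.continuous.comp (continuous_stoneCechUnit.subtype_mk _)
  have hlim : Tendsto (fun x => e ⟨stoneCechUnit x, hXY ⟨x, rfl⟩⟩) (zeroSetFilter z)
      (𝓝 fun i => hullExtend (continuous_pi_iff.1 hη i) ⟨z, hz⟩) :=
    tendsto_pi_nhds.2 fun i => tendsto_const_nhds.congr'
      ((eventually_eq_hullExtend (continuous_pi_iff.1 hη i) ⟨z, hz⟩).mono fun _ hx => hx.symm)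
  have : (zeroSetFilter z).NeBot := hz
  obtain ⟨y, hy⟩ := he.isClosed_range.mem_of_tendsto hlim (.of_forall fun _ => mem_range_self _)
  rw [← hy] at hlim
  exact mem_of_tendsto_zeroSetFilter hXY (z := ⟨z, hz⟩) (he.isInducing.tendsto_nhds_iff.2 hlim)

theorem hewittNachbin_eq_realHull : hewittNachbin X = realHull X :=
  Subset.antisymm (sInter_subset_of_mem ⟨range_subset_realHull, isRealcompact_realHull⟩)
    (subset_sInter fun _ hY => realHull_subset_of_isRealcompact hY.1 hY.2)

theorem IsRealcompact.isDieudonneComplete {Y : Type u} [TopologicalSpace Y]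
    (h : IsRealcompact Y) : IsDieudonneComplete Y := by
  obtain ⟨ι, e, he⟩ := h
  let _ := UniformSpace.comap e inferInstance
  have hu : IsUniformInducing e := ⟨rfl⟩
  exact ⟨he.isEmbedding.t0Space, UniformSpace.comap e inferInstance,
    he.isInducing.eq_induced.symm,
    (completeSpace_iff_isComplete_range hu).2 he.isClosed_range.isComplete⟩

end Realcompact

section Cellularity

theorem IsCellularFamily.mk_le_cellularity {X : Type u} [TopologicalSpace X] {𝒞 : Set (Set X)}
    (h : IsCellularFamily 𝒞) : #𝒞 ≤ cellularity X :=
  (le_ciSup (f := fun F : {F : Set (Set X) // IsCellularFamily F} => #F.1) bddAbove_of_small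
    ⟨𝒞, h⟩).trans (le_max_right _ _)

theorem cellularity_le_iff {X : Type u} [TopologicalSpace X] {κ : Cardinal.{u}} :
    cellularity X ≤ κ ↔ ℵ₀ ≤ κ ∧ ∀ 𝒞 : Set (Set X), IsCellularFamily 𝒞 → #𝒞 ≤ κ := by
  refine ⟨fun h => ⟨(le_max_left _ _).trans h, fun 𝒞 h𝒞 => h𝒞.mk_le_cellularity.trans h⟩,
    fun ⟨h₀, h⟩ => max_le h₀ (ciSup_le' fun 𝒞 => h 𝒞.1 𝒞.2)⟩

theorem isCellularFamily_range_diff {X : Type*} [TopologicalSpace X] {ι : Type*} {U : ι → Set X}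
    (hU : ∀ i, IsOpen (U i)) (hd : Pairwise (Function.onFun Disjoint U)) :
    IsCellularFamily (range U \ {∅}) := by
  refine ⟨?_, ?_⟩
  · rintro _ ⟨⟨i, rfl⟩, hi⟩
    exact ⟨hU i, nonempty_iff_ne_empty.2 hi⟩
  · rintro _ ⟨⟨i, rfl⟩, -⟩ _ ⟨⟨j, rfl⟩, -⟩ hij
    exact hd (ne_of_apply_ne U hij)

theorem cellularity_le_of_denseRange {X Y : Type u} [TopologicalSpace X] [TopologicalSpace Y]
    {φ : X → Y} (hφ : Continuous φ) (hd : DenseRange φ) : cellularity Y ≤ cellularity X := by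
  refine cellularity_le_iff.2 ⟨le_max_left _ _, fun 𝒞 h𝒞 => ?_⟩
  have hne : ∀ V ∈ 𝒞, (φ ⁻¹' V).Nonempty := fun V hV =>
    hd.exists_mem_open (h𝒞.1 V hV).1 (h𝒞.1 V hV).2
  have hcell : IsCellularFamily (preimage φ '' 𝒞) := by
    refine ⟨?_, ?_⟩
    · rintro _ ⟨V, hV, rfl⟩
      exact ⟨(h𝒞.1 V hV).1.preimage hφ, hne V hV⟩
    · rintro _ ⟨V, hV, rfl⟩ _ ⟨W, hW, rfl⟩ hVW
      exact (h𝒞.2 hV hW (ne_of_apply_ne _ hVW)).preimage φ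
  have hinj : InjOn (preimage φ) 𝒞 := fun V hV W hW hVW => by
    obtain ⟨x, hx⟩ := hne V hV
    exact h𝒞.2.elim_set hV hW (φ x) hx (hVW ▸ hx : x ∈ φ ⁻¹' W)
  exact (mk_image_eq_of_injOn _ _ hinj).symm.trans_le hcell.mk_le_cellularity

end Cellularity

section Nonmeasurable

/-- A type whose cardinality is Ulam-nonmeasurable: it carries no countably complete
nonprincipal ultrafilter. -/
def IsNonmeasurable (ι : Type*) : Prop :=
  ∀ F : Ultrafilter ι, CountableInterFilter (F : Filter ι) → ∃ a, {a} ∈ F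

theorem isNonmeasurable_nat : IsNonmeasurable ℕ := by
  intro F _
  by_contra! h
  have h' : ∀ᶠ x in (F : Filter ℕ), ∀ n : ℕ, x ≠ n :=
    eventually_countable_forall.2 fun n => Ultrafilter.compl_mem_iff_notMem.2 (h n)
  obtain ⟨x, hx⟩ := h'.exists
  exact hx x rfl

theorem IsNonmeasurable.of_injective {κ ι : Type*} (hκ : IsNonmeasurable κ) {e : ι → Set κ}
    (he : Function.Injective e) : IsNonmeasurable ι := by
  intro F _
  let b : Set κ := {j | ∀ᶠ x in F, j ∈ e x}
  have hb : ∀ j, ∀ᶠ x in F, (j ∈ e x ↔ j ∈ b) := fun j => by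
    by_cases hj : j ∈ b
    · exact Eventually.mono hj fun x hx => iff_of_true hx hj
    · exact (Ultrafilter.eventually_not.2 hj).mono fun x hx => iff_of_false hx hj
  by_cases h : ∀ᶠ x in F, e x = b
  · obtain ⟨a, ha⟩ := h.exists
    exact ⟨a, h.mono fun x hx => he (hx.trans ha.symm)⟩
  have h' : ∀ᶠ x in F, ∃ j, ¬(j ∈ e x ↔ j ∈ b) :=
    (Ultrafilter.eventually_not.2 h).mono fun x hx => by
      by_contra! hx'
      exact hx (Set.ext hx')
  obtain ⟨x₀, j₀, -⟩ := h'.exists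
  have : Nonempty κ := ⟨j₀⟩
  obtain ⟨T, hT⟩ := h'.choice
  obtain ⟨j, hj⟩ := hκ (F.map T) (inferInstanceAs (CountableInterFilter (map T F)))
  have hj' : ∀ᶠ x in F, T x = j := hj
  obtain ⟨x, hxT, hx, hxj⟩ := (hT.and (hj'.and (hb j))).exists
  exact (hxT (hx ▸ hxj)).elim

theorem IsNonmeasurable.of_mk_le {κ ι : Type u} (hκ : IsNonmeasurable κ) (h : #ι ≤ #κ) :
    IsNonmeasurable ι := by
  obtain ⟨e⟩ := h
  exact hκ.of_injective (singleton_injective.comp e.injective)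

theorem isNonmeasurable_of_mk_le_two_power_continuum {ι : Type u}
    (h : #ι ≤ 2 ^ (𝔠 : Cardinal.{u})) : IsNonmeasurable ι := by
  have h1 : IsNonmeasurable (Set ℕ) := isNonmeasurable_nat.of_injective Function.injective_id
  have h2 : lift.{0} #ι ≤ lift.{u} #(Set (Set ℕ)) := by simpa using h
  obtain ⟨e⟩ := lift_mk_le'.1 h2
  exact h1.of_injective e.injective

theorem IsCellularFamily.exists_mem_of_sUnion_mem {M : Type u} [TopologicalSpace M]
    (hM : IsNonmeasurable (cellularity M).out) {𝒞 : Set (Set M)} (h𝒞 : IsCellularFamily 𝒞)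
    {F : Filter M} [F.NeBot] [CountableInterFilter F]
    (hF : ∀ U, IsOpen U → U ∈ F ∨ Uᶜ ∈ F) (h : ⋃₀ 𝒞 ∈ F) : ∃ V ∈ 𝒞, V ∈ F := by
  have h' : ∀ᶠ x in F, ∃ V : 𝒞, x ∈ V.1 := mem_of_superset h fun x ⟨V, hV, hx⟩ => ⟨⟨V, hV⟩, hx⟩
  obtain ⟨x₀, V₀, -⟩ := h'.exists
  have : Nonempty 𝒞 := ⟨V₀⟩
  obtain ⟨T, hT⟩ := h'.choice
  have hmem : ∀ J : Set 𝒞, ∀ᶠ x in F, (x ∈ ⋃ V ∈ J, V.1 ↔ T x ∈ J) := fun J =>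
    hT.mono fun x hx => by
      refine ⟨fun hxJ => ?_, fun hxJ => mem_biUnion hxJ hx⟩
      obtain ⟨V, hV, hxV⟩ := mem_iUnion₂.1 hxJ
      have : T x = V := Subtype.ext (h𝒞.2.elim_set (T x).2 V.2 x hx hxV)
      exact this ▸ hV
  have hultra : ∀ J : Set 𝒞, Jᶜ ∉ F.map T ↔ J ∈ F.map T := fun J => by
    refine ⟨fun hJ => ?_, fun hJ => (compl_notMem hJ)⟩
    rcases hF (⋃ V ∈ J, V.1) (isOpen_biUnion fun V _ => (h𝒞.1 V.1 V.2).1) with hJ' | hJ'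
    · exact (Eventually.and hJ' (hmem J)).mono fun x hx => hx.2.1 hx.1
    · exact (hJ ((Eventually.and hJ' (hmem J)).mono fun x hx hxJ => hx.1 (hx.2.2 hxJ))).elim
  have hN : IsNonmeasurable 𝒞 := hM.of_mk_le (h𝒞.mk_le_cellularity.trans_eq (mk_out _).symm)
  obtain ⟨V, hV⟩ := hN (.ofComplNotMemIff (F.map T) hultra)
    (inferInstanceAs (CountableInterFilter (F.map T)))
  have hV' : ∀ᶠ x in F, T x = V := hV
  exact ⟨V, V.2, (hT.and hV').mono fun x hx => hx.2 ▸ hx.1⟩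

end Nonmeasurable

section StoneSets

variable {M : Type*} [PseudoMetricSpace M] (r : M → M → Prop) (ε δ : ℝ)

/-- The open sets of Stone's proof that metric spaces are paracompact: for each `δ > 0` they form
a disjoint family indexed by `a`, and for `δ = 1, 1/2, 1/3, …` together they cover the space. -/
def stoneSet (a : M) : Set M :=
  Metric.thickening δ {m | dist m a ≤ ε - 3 * δ ∧ ∀ b, r b a → ε ≤ dist m b}

theorem pairwise_disjoint_stoneSet [Std.Trichotomous r] :
    Pairwise (Function.onFun Disjoint (stoneSet r ε δ)) := by
  have key : ∀ a b, r a b → Disjoint (stoneSet r ε δ a) (stoneSet r ε δ b) := fun a b hr => by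
    refine disjoint_left.2 fun m hma hmb => ?_
    obtain ⟨x, ⟨hxa, -⟩, hmx⟩ := Metric.mem_thickening_iff.1 hma
    obtain ⟨y, ⟨-, hy⟩, hmy⟩ := Metric.mem_thickening_iff.1 hmb
    have hya := hy a hr
    have htri := dist_triangle4 y m x a
    rw [dist_comm y m] at htri
    linarith [dist_nonneg (x := m) (y := x)]
  intro a b hab
  rcases trichotomous_of r a b with h | h | h
  · exact key a b h
  · exact (hab h).elim
  · exact (key b a h).symm

theorem stoneSet_subset_ball {δ : ℝ} (hδ : 0 < δ) (a : M) :
    stoneSet r ε δ a ⊆ Metric.ball a ε := fun m hm => by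
  obtain ⟨y, hy, hmy⟩ := Metric.mem_thickening_iff.1 hm
  have htri := dist_triangle m y a
  exact Metric.mem_ball.2 (by linarith [hy.1])

theorem exists_mem_stoneSet [IsWellFounded M r] {ε : ℝ} (hε : 0 < ε) (m : M) :
    ∃ (n : ℕ) (a : M), m ∈ stoneSet r ε (1 / (n + 1)) a := by
  obtain ⟨a, ha, hmin⟩ := (IsWellFounded.wf (r := r)).has_min {a | dist m a < ε}
    ⟨m, by simpa using hε⟩
  have ha' : 0 < (ε - dist m a) / 3 := div_pos (sub_pos.2 ha) (by norm_num)
  obtain ⟨n, hn⟩ := exists_nat_one_div_lt ha'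
  refine ⟨n, a, Metric.self_subset_thickening (by positivity) _ ⟨?_, fun b hb => ?_⟩⟩
  · linarith
  · exact not_lt.1 fun h => hmin b h hb

end StoneSets

section DieudonneCompletion

theorem exists_ball_mem_of_decides_isOpen {M : Type u} [PseudoMetricSpace M]
    (hM : IsNonmeasurable (cellularity M).out) {F : Filter M} [F.NeBot] [CountableInterFilter F]
    (hF : ∀ U, IsOpen U → U ∈ F ∨ Uᶜ ∈ F) {ε : ℝ} (hε : 0 < ε) : ∃ a, Metric.ball a ε ∈ F := by
  let S : ℕ → M → Set M := fun n => stoneSet WellOrderingRel ε (1 / (n + 1))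
  have hSo : ∀ n a, IsOpen (S n a) := fun n a => Metric.isOpen_thickening
  obtain ⟨n, hn⟩ : ∃ n, ⋃ a, S n a ∈ F := by
    by_contra! h
    have h' : ∀ᶠ m in F, ∀ n, m ∉ ⋃ a, S n a := eventually_countable_forall.2 fun n =>
      (hF _ (isOpen_iUnion (hSo n))).resolve_left (h n)
    obtain ⟨m, hm⟩ := h'.exists
    obtain ⟨n, a, ha⟩ := exists_mem_stoneSet WellOrderingRel hε m
    exact hm n (mem_iUnion.2 ⟨a, ha⟩)
  have hcell := isCellularFamily_range_diff (hSo n) (pairwise_disjoint_stoneSet _ _ _)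
  rw [← sUnion_range, ← sUnion_sdiff_singleton_empty] at hn
  obtain ⟨_, ⟨⟨a, rfl⟩, -⟩, ha⟩ := hcell.exists_mem_of_sUnion_mem hM hF hn
  exact ⟨a, mem_of_superset ha (stoneSet_subset_ball _ _ (by positivity) a)⟩

theorem cauchy_of_decides_isOpen {M : Type u} [PseudoMetricSpace M]
    (hM : IsNonmeasurable (cellularity M).out) {F : Filter M} [F.NeBot] [CountableInterFilter F]
    (hF : ∀ U, IsOpen U → U ∈ F ∨ Uᶜ ∈ F) : Cauchy F := by
  refine Metric.cauchy_iff.2 ⟨inferInstance, fun ε hε => ?_⟩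
  obtain ⟨a, ha⟩ := exists_ball_mem_of_decides_isOpen hM hF (half_pos hε)
  refine ⟨_, ha, fun x hx y hy => (dist_triangle_right x y a).trans_lt ?_⟩
  linarith [Metric.mem_ball.1 hx, Metric.mem_ball.1 hy]

open Uniformity SetRel in
theorem exists_isCountablyGenerated_le_of_mem_uniformity {Y : Type*} [s : UniformSpace Y]
    {V : SetRel Y Y} (hV : V ∈ 𝓤 Y) :
    ∃ t : UniformSpace Y, s ≤ t ∧ IsCountablyGenerated 𝓤[t] ∧ V ∈ 𝓤[t] := by
  have hstep : ∀ W : {W : SetRel Y Y // W ∈ 𝓤 Y ∧ W.IsSymm},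
      ∃ W' : {W : SetRel Y Y // W ∈ 𝓤 Y ∧ W.IsSymm}, W'.1 ○ W'.1 ⊆ W.1 := fun W => by
    obtain ⟨t, ht, hts, htW⟩ := comp_symm_mem_uniformity_sets W.2.1
    exact ⟨⟨t, ht, hts⟩, htW⟩
  choose next hnext using hstep
  let W : ℕ → {W : SetRel Y Y // W ∈ 𝓤 Y ∧ W.IsSymm} := fun n =>
    next^[n] ⟨symmetrize V, symmetrize_mem_uniformity hV, inferInstance⟩
  have hW : ∀ n, (W (n + 1)).1 ○ (W (n + 1)).1 ⊆ (W n).1 := fun n => by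
    simp only [W, Function.iterate_succ_apply']
    exact hnext _
  let t : UniformSpace Y := .ofCore
    { uniformity := ⨅ n, 𝓟 (W n).1
      refl := le_iInf fun n => refl_le_uniformity.trans (le_principal_iff.2 (W n).2.1)
      symm := tendsto_iInf_iInf fun n => tendsto_principal_principal.2 fun p hp =>
        (W n).2.2.symm _ _ hp
      comp := le_iInf fun n => le_principal_iff.2 (mem_of_superset
        (mem_lift' (mem_iInf_of_mem (n + 1) (mem_principal_self _))) (hW n)) }
  have ht : 𝓤[t] = ⨅ n, 𝓟 (W n).1 := rfl
  refine ⟨t, UniformSpace.le_def.2 ?_, ?_, ?_⟩ <;> rw [ht]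
  · exact le_iInf fun n => le_principal_iff.2 (W n).2.1
  · infer_instance
  · exact mem_iInf_of_mem 0 (mem_principal.2 symmetrize_subset_self)

open Uniformity in
theorem exists_pseudoMetricSpace_of_mem_uniformity {Y : Type*} [s : UniformSpace Y]
    {V : SetRel Y Y} (hV : V ∈ 𝓤 Y) :
    ∃ m : PseudoMetricSpace Y, s ≤ m.toUniformSpace ∧ V ∈ 𝓤[m.toUniformSpace] := by
  obtain ⟨t, hst, ht, hVt⟩ := exists_isCountablyGenerated_le_of_mem_uniformity hV
  obtain ⟨m, rfl⟩ := @UniformSpace.metrizable_uniformity Y t ht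
  exact ⟨m, hst, hVt⟩

variable {X : Type u} [TopologicalSpace X]

theorem cauchy_map_zeroSetFilter_of_pseudoMetricSpace
    (hX : IsNonmeasurable (cellularity X).out) {M : Type u} [PseudoMetricSpace M] {φ : X → M}
    (hφ : Continuous φ) (hd : DenseRange φ) (z : realHull X) :
    Cauchy ((zeroSetFilter (z : StoneCech X)).map φ) := by
  have hM : IsNonmeasurable (cellularity M).out :=
    hX.of_mk_le (by simpa using cellularity_le_of_denseRange hφ hd)
  exact cauchy_of_decides_isOpen hM fun U hU =>
    ((isCozeroSet_of_isOpen hU).preimage hφ).mem_or_compl_mem_zeroSetFilter z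

theorem cauchy_map_zeroSetFilter (hX : IsNonmeasurable (cellularity X).out) {Y : Type u}
    [UniformSpace Y] {η : X → Y} (hη : Continuous η) (hd : DenseRange η) (z : realHull X) :
    Cauchy ((zeroSetFilter (z : StoneCech X)).map η) := by
  refine ⟨inferInstance, fun V hV => ?_⟩
  obtain ⟨m, hm, hVm⟩ := exists_pseudoMetricSpace_of_mem_uniformity hV
  have hle := UniformSpace.toTopologicalSpace_mono hm
  exact (@cauchy_map_zeroSetFilter_of_pseudoMetricSpace X _ hX Y m η (continuous_le_rng hle hη)
    (fun y => closure.mono hle (hd y)) z).2 hVm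

theorem realHull_subset_of_isDieudonneComplete (hX : IsNonmeasurable (cellularity X).out)
    {Y : Set (StoneCech X)} (hXY : range (stoneCechUnit : X → StoneCech X) ⊆ Y)
    (hY : IsDieudonneComplete Y) : realHull X ⊆ Y := by
  obtain ⟨-, s, hs, hcomp⟩ := hY
  intro z hz
  let η : X → Y := fun x => ⟨stoneCechUnit x, hXY ⟨x, rfl⟩⟩
  have hη : Continuous η := continuous_stoneCechUnit.subtype_mk _
  have hd : DenseRange η := Subtype.dense_iff.2 fun z _ => by
    rw [← range_comp]
    exact denseRange_stoneCechUnit z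
  obtain ⟨y, hy⟩ := hcomp.complete
    (@cauchy_map_zeroSetFilter X _ hX Y s η (hs ▸ hη) (hs ▸ hd) ⟨z, hz⟩)
  exact mem_of_tendsto_zeroSetFilter hXY (z := ⟨z, hz⟩) (y := y) (hs ▸ hy)

theorem dieudonneCompletion_eq_realHull (hX : IsNonmeasurable (cellularity X).out) :
    dieudonneCompletion X = realHull X :=
  Subset.antisymm
    (sInter_subset_of_mem ⟨range_subset_realHull, isRealcompact_realHull.isDieudonneComplete⟩)
    (subset_sInter fun _ hY => realHull_subset_of_isDieudonneComplete hX hY.1 hY.2)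

end DieudonneCompletion

section NoMonochromaticTriangle

/-- The order of the Erdős–Rado tree of a colouring of the pairs of a well-ordered set: `α` lies
below `β` if `α < β` and every node below both of them sees them in the same colour. -/
def TreeLT {I κ : Type*} [LinearOrder I] [WellFoundedLT I] (col : I → I → κ)
    (α β : I) : Prop :=
  α < β ∧ ∀ α' < α, TreeLT col α' β → col α' α = col α' β
termination_by wellFounded_lt.wrap α
decreasing_by assumption

variable {I κ : Type*} [LinearOrder I] [WellFoundedLT I] (col : I → I → κ)

/-- The ordered pairs of colours in which the nodes below `β` see `β`. Recording pairs rather than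
single colours keeps track of the order of the nodes. -/
def treeCode (β : I) : Set (κ × κ) :=
  {q | ∃ α' α, α' ≤ α ∧ TreeLT col α' β ∧ TreeLT col α β ∧ col α' β = q.1 ∧ col α β = q.2}

variable {col}

theorem treeLT_iff {α β : I} :
    TreeLT col α β ↔ α < β ∧ ∀ α' < α, TreeLT col α' β → col α' α = col α' β := by
  rw [TreeLT]

theorem TreeLT.lt {α β : I} (h : TreeLT col α β) : α < β :=
  (treeLT_iff.1 h).1

theorem TreeLT.col_eq {α α' β : I} (h : TreeLT col α β) (h' : TreeLT col α' β) (hlt : α' < α) :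
    col α' α = col α' β :=
  (treeLT_iff.1 h).2 α' hlt h'

variable (hcol : ∀ a b c, a < b → b < c → col a b = col a c → col a c ≠ col b c)
include hcol

theorem TreeLT.eq_of_col_eq {α α' β : I} (h : TreeLT col α β) (h' : TreeLT col α' β)
    (he : col α' β = col α β) : α' = α := by
  rcases lt_trichotomy α' α with hlt | rfl | hlt
  · exact (hcol _ _ _ hlt h.lt (h.col_eq h' hlt) he).elim
  · rfl
  · exact (hcol _ _ _ hlt h'.lt (h'.col_eq h hlt) he.symm).elim

theorem TreeLT.of_treeCode_eq {α β γ : I} (hcode : treeCode col β = treeCode col γ)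
    (hα : TreeLT col α β) : TreeLT col α γ ∧ col α β = col α γ := by
  induction α using WellFoundedLT.induction generalizing β γ with
  | ind α ih =>
    have hmem : (col α β, col α β) ∈ treeCode col γ := hcode ▸ ⟨α, α, le_rfl, hα, hα, rfl, rfl⟩
    obtain ⟨-, α', -, -, hα', -, hc : col α' γ = col α β⟩ := hmem
    rcases lt_trichotomy α α' with hlt | rfl | hlt
    · have hαγ : TreeLT col α γ := treeLT_iff.2 ⟨hlt.trans hα'.lt, fun δ hδ hδγ => by
        obtain ⟨hδβ, hδc⟩ := ih δ hδ hcode.symm hδγ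
        rw [hα.col_eq hδβ hδ, hδc]⟩
      have hpair : (col α γ, col α' γ) ∈ treeCode col β :=
        hcode ▸ ⟨α, α', hlt.le, hαγ, hα', rfl, rfl⟩
      obtain ⟨δ, δ', hle, hδ, hδ', hδc : col δ β = col α γ, hδc' : col δ' β = col α' γ⟩ := hpair
      obtain rfl : δ' = α := hα.eq_of_col_eq hcol hδ' (hδc'.trans hc)
      rcases hle.eq_or_lt with rfl | hδlt
      · exact ⟨hαγ, hδc⟩
      · obtain ⟨hδγ, hδβγ⟩ := ih δ hδlt hcode hδ
        exact (hδlt.ne (hαγ.eq_of_col_eq hcol hδγ (hδβγ.symm.trans hδc))).elim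
    · exact ⟨hα', hc.symm⟩
    · obtain ⟨hα'β, hα'c⟩ := ih α' hlt hcode.symm hα'
      exact (hlt.ne (hα.eq_of_col_eq hcol hα'β (hα'c.symm.trans hc))).elim

theorem treeCode_injective : Function.Injective (treeCode col) := by
  have not_lt_of_eq : ∀ {β γ}, treeCode col β = treeCode col γ → ¬β < γ := fun hcode hlt =>
    have hβγ : TreeLT col _ _ :=
      treeLT_iff.2 ⟨hlt, fun _ _ hδ => (hδ.of_treeCode_eq hcol hcode.symm).2.symm⟩
    (hβγ.of_treeCode_eq hcol hcode.symm).1.lt.false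
  exact fun β γ hcode =>
    le_antisymm (not_lt.1 (not_lt_of_eq hcode.symm)) (not_lt.1 (not_lt_of_eq hcode))

end NoMonochromaticTriangle

theorem mk_le_two_power_of_no_monochromatic_triangle {I κ : Type u} [LinearOrder I]
    [WellFoundedLT I] [Infinite κ] {col : I → I → κ}
    (hcol : ∀ a b c, a < b → b < c → col a b = col a c → col a c ≠ col b c) :
    #I ≤ 2 ^ #κ := by
  simpa [mul_eq_self (aleph0_le_mk κ)] using mk_le_of_injective (treeCode_injective hcol)

theorem mk_le_two_power_of_disjoint_cosets {G I : Type u} [Group G] {κ : Cardinal.{u}}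
    (hκ : ℵ₀ ≤ κ) (x : I → G) (N : I → Subgroup G) [∀ i, (N i).Normal]
    (hN : ∀ i, #(G ⧸ N i) ≤ κ)
    (hd : Pairwise fun i j => Disjoint (x i • (N i : Set G)) (x j • N j)) :
    #I ≤ 2 ^ κ := by
  obtain ⟨_, _⟩ := exists_wellFoundedLT I
  have : Infinite κ.out := infinite_iff.2 (by simpa using hκ)
  let e i : G ⧸ N i ↪ κ.out :=
    Classical.choice ((Cardinal.le_def _ _).1 (by simpa using hN i))
  have mem_iff : ∀ i (y z : G), e i y = e i z ↔ y⁻¹ * z ∈ N i := by simp [QuotientGroup.eq]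
  let col i j := (e i (x j), e j (x i))
  suffices hcol : ∀ a b c, a < b → b < c → col a b = col a c → col a c ≠ col b c by
    simpa [mul_eq_self hκ] using mk_le_two_power_of_no_monochromatic_triangle hcol
  intro a b c hab hbc hac hbc'
  have hNa : (x b)⁻¹ * x c ∈ N a := (mem_iff ..).1 (congrArg Prod.fst hac)
  have hNc : (x a)⁻¹ * x b ∈ N c := (mem_iff ..).1 (congrArg Prod.snd hbc')
  let t := x a * ((x b)⁻¹ * x c)
  have hta : t ∈ x a • (N a : Set G) := ⟨_, hNa, rfl⟩
  have htc : t ∈ x c • (N c : Set G) :=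
    mem_leftCoset_iff _ |>.2 <| by
      simpa [t, mul_assoc] using
        (inferInstance : (N c).Normal).conj_mem _ (inv_mem hNc) ((x c)⁻¹ * x b)
  exact disjoint_left.1 (hd (hab.trans hbc).ne) hta htc

section SmKernels

theorem mk_le_continuum_of_secondCountableTopology (H : Type u) [TopologicalSpace H] [T0Space H]
    [SecondCountableTopology H] : #H ≤ 𝔠 := by
  obtain ⟨S, -, hS⟩ := exists_seq_separating H isOpen_empty univ
  have hinj : Function.Injective fun x => {n | x ∈ S n} := fun x y h =>
    hS x trivial y trivial fun n => Set.ext_iff.1 h n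
  simpa using lift_mk_le_lift_mk_of_injective hinj

variable {G : Type u} [Group G] [TopologicalSpace G]

/-- The kernels of continuous homomorphisms to separable metrizable paratopological groups. For
metrizable groups separability is phrased as second countability, which passes to subgroups. -/
def IsSmKernel (N : Subgroup G) : Prop :=
  ∃ (H : Type u) (_ : Group H) (_ : TopologicalSpace H) (_ : ContinuousMul H)
    (_ : SecondCountableTopology H) (_ : TopologicalSpace.MetrizableSpace H) (p : G →* H),
    Continuous p ∧ p.ker = N

theorem IsSmKernel.normal {N : Subgroup G} (hN : IsSmKernel N) : N.Normal := by
  obtain ⟨H, _, _, _, _, _, p, -, rfl⟩ := hN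
  infer_instance

/-- The sm-kernels of `G`, as an index set: the continuous separable metrizable quotients of `G`
up to isomorphism of the underlying groups. -/
abbrev SmKernel (G : Type u) [Group G] [TopologicalSpace G] : Type u :=
  {N : Subgroup G // IsSmKernel N}

instance (N : SmKernel G) : N.1.Normal := N.2.normal

theorem IsSmKernel.iInf {ι : Type} [Countable ι] {N : ι → Subgroup G}
    (hN : ∀ i, IsSmKernel (N i)) : IsSmKernel (⨅ i, N i) := by
  choose H _ _ _ _ _ p hp hpN using hN
  refine ⟨∀ i, H i, inferInstance, inferInstance, inferInstance, inferInstance, inferInstance,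
    MonoidHom.pi p, continuous_pi hp, ?_⟩
  ext x
  simp [MonoidHom.mem_ker, funext_iff, Subgroup.mem_iInf, ← hpN]

theorem IsSmKernel.inf {N M : Subgroup G} (hN : IsSmKernel N) (hM : IsSmKernel M) :
    IsSmKernel (N ⊓ M) := by
  rw [inf_eq_iInf]
  exact .iInf (Bool.forall_bool.2 ⟨hM, hN⟩)

theorem IsSmKernel.mk_quotient_le {N : Subgroup G} (hN : IsSmKernel N) : #(G ⧸ N) ≤ 𝔠 := by
  obtain ⟨H, _, _, _, _, _, p, -, rfl⟩ := hN
  exact (mk_le_of_injective (QuotientGroup.kerLift_injective p)).trans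
    (mk_le_continuum_of_secondCountableTopology H)

theorem isSimplySmFactorizable_iff : IsSimplySmFactorizable G ↔ ∀ U : Set G, IsCozeroSet U →
    ∃ N : Subgroup G, IsSmKernel N ∧ ∀ x y, x⁻¹ * y ∈ N → x ∈ U → y ∈ U := by
  refine forall₂_congr fun U _ => ⟨?_, ?_⟩
  · rintro ⟨H, _, _, _, _, _, p, hp, -, hpU⟩
    let _ := TopologicalSpace.metrizableSpaceMetric H
    have := UniformSpace.secondCountable_of_separable H
    refine ⟨p.ker, ⟨H, _, _, ‹_›, this, ‹_›, p, hp, rfl⟩, fun x y hxy hx => ?_⟩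
    rw [← hpU]
    exact ⟨x, hx, (p.eq_iff.2 hxy).symm⟩
  · rintro ⟨_, ⟨H, _, _, _, _, _, p, hp, rfl⟩, hU⟩
    have := Submonoid.continuousMul p.range.toSubmonoid
    have : SecondCountableTopology p.range :=
      TopologicalSpace.Subtype.secondCountableTopology (p.range : Set H)
    refine ⟨p.range, inferInstance, instTopologicalSpaceSubtype, ‹_›, inferInstance,
      IsEmbedding.subtypeVal.metrizableSpace, p.rangeRestrict, hp.subtype_mk _,
      p.rangeRestrict_surjective, Subset.antisymm ?_ (subset_preimage_image _ _)⟩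
    rintro y ⟨x, hx, hxy⟩
    exact hU x y (p.eq_iff.1 (congrArg Subtype.val hxy).symm) hx

theorem IsSimplySmFactorizable.exists_smKernel (hG : IsSimplySmFactorizable G) {f : G → ℝ}
    (hf : Continuous f) : ∃ N : SmKernel G, ∀ x y, x⁻¹ * y ∈ N.1 → f x = f y := by
  choose N hN hNf using fun q : ℚ => isSimplySmFactorizable_iff.1 hG _
    ((isCozeroSet_of_isOpen (isOpen_Ioi (a := (q : ℝ)))).preimage hf)
  have le_of_mem : ∀ x y, x⁻¹ * y ∈ ⨅ q, N q → f x ≤ f y := fun x y hxy =>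
    le_of_forall_rat_lt_imp_le fun q hq =>
      (hNf q x y (Subgroup.mem_iInf.1 hxy q) hq).le
  refine ⟨⟨⨅ q, N q, .iInf hN⟩, fun x y hxy => le_antisymm (le_of_mem x y hxy) (le_of_mem y x ?_)⟩
  simpa using inv_mem hxy

theorem IsSimplySmFactorizable.exists_smKernel_subset [CompletelyRegularSpace G]
    (hG : IsSimplySmFactorizable G) {U : Set G} (hU : U ∈ 𝓝 (1 : G)) :
    ∃ N : SmKernel G, (N.1 : Set G) ⊆ U := by
  obtain ⟨f, hf, h0, h1⟩ := CompletelyRegularSpace.completely_regular_isOpen (1 : G) _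
    isOpen_interior (mem_interior_iff_mem_nhds.2 hU)
  obtain ⟨N, hNf⟩ := hG.exists_smKernel (continuous_subtype_val.comp hf)
  refine ⟨N, fun x hx => interior_subset (by_contra fun hxU => ?_)⟩
  have hfx : f 1 = f x := Subtype.ext (hNf 1 x (by simpa using hx))
  exact zero_ne_one (h0.symm.trans (hfx.trans (h1 hxU)))

end SmKernels

section AssociatedGroup

variable {G : Type u} [Group G] [TopologicalSpace G]

theorem cellularity_le_cellularity_associatedGroup :
    cellularity G ≤ cellularity (AssociatedGroup G) :=
  cellularity_le_of_denseRange (φ := fun x : AssociatedGroup G => (x : G))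
    (continuous_id_iff_le.2 inf_le_left) Function.surjective_id.denseRange

theorem nhds_one_associatedGroup :
    𝓝 (1 : AssociatedGroup G) = 𝓝 (1 : G) ⊓ comap (fun x : G => x⁻¹) (𝓝 (1 : G)) := by
  refine (nhds_inf (a := (1 : G))).trans (congrArg (𝓝 (1 : G) ⊓ ·) ?_)
  exact (nhds_induced (fun x : G => x⁻¹) 1).trans (by rw [inv_one])

variable [CompletelyRegularSpace G]

theorem IsSimplySmFactorizable.exists_smKernel_subset_associatedGroup
    (hG : IsSimplySmFactorizable G) {U : Set (AssociatedGroup G)}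
    (hU : U ∈ 𝓝 (1 : AssociatedGroup G)) :
    ∃ N : Subgroup (AssociatedGroup G),
      IsSmKernel (G := G) N ∧ (N : Set (AssociatedGroup G)) ⊆ U := by
  rw [nhds_one_associatedGroup] at hU
  obtain ⟨A, hA, B, ⟨V, hV, hVB⟩, rfl⟩ := hU
  obtain ⟨⟨N, hN⟩, hNV⟩ := hG.exists_smKernel_subset (inter_mem hA hV)
  exact ⟨N, hN, fun x hx => ⟨(hNV hx).1, hVB (hNV (N.inv_mem hx)).2⟩⟩

theorem IsSimplySmFactorizable.narrownessIndex_associatedGroup_le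
    (hG : IsSimplySmFactorizable G) : narrownessIndex (AssociatedGroup G) ≤ 𝔠 := by
  refine csInf_le' ⟨aleph0_le_continuum, fun U hU h1 => ?_⟩
  obtain ⟨N, hN, hNU⟩ := hG.exists_smKernel_subset_associatedGroup (hU.mem_nhds h1)
  have : N.Normal := hN.normal
  have hout : ∀ g : AssociatedGroup G, (g : AssociatedGroup G ⧸ N).out⁻¹ * g ∈ N := fun g =>
    QuotientGroup.eq.1 (QuotientGroup.out_eq' _)
  refine ⟨range (Quotient.out : AssociatedGroup G ⧸ N → _), eq_univ_of_forall fun g => ?_,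
    eq_univ_of_forall fun g => ?_, mk_range_le.trans hN.mk_quotient_le⟩
  · exact ⟨_, mem_range_self _, _, hNU (hout g), mul_inv_cancel_left _ _⟩
  · exact ⟨_, hNU (this.mem_comm (hout g)), _, mem_range_self _, inv_mul_cancel_right _ _⟩

theorem IsSimplySmFactorizable.cellularity_associatedGroup_le [ContinuousMul G]
    (hG : IsSimplySmFactorizable G) :
    cellularity (AssociatedGroup G) ≤ 2 ^ (𝔠 : Cardinal.{u}) := by
  refine cellularity_le_iff.2 ⟨aleph0_le_continuum.trans (cantor _).le, fun 𝒞 h𝒞 => ?_⟩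
  choose x hx using fun U : 𝒞 => (h𝒞.1 U U.2).2
  have exists_coset_subset : ∀ U : 𝒞, ∃ N : Subgroup (AssociatedGroup G),
      IsSmKernel (G := G) N ∧ x U • (N : Set (AssociatedGroup G)) ⊆ U := fun U => by
    have hU : (fun y => x U * y) ⁻¹' U ∈ 𝓝 (1 : AssociatedGroup G) :=
      (continuous_const_mul (x U)).continuousAt.preimage_mem_nhds
        ((h𝒞.1 U U.2).1.mem_nhds (by simpa using hx U))
    obtain ⟨N, hN, hNU⟩ := hG.exists_smKernel_subset_associatedGroup hU
    exact ⟨N, hN, image_subset_iff.2 hNU⟩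
  choose N hN hNU using exists_coset_subset
  have : ∀ U, (N U).Normal := fun U => (hN U).normal
  exact mk_le_two_power_of_disjoint_cosets aleph0_le_continuum x N
    (fun U => (hN U).mk_quotient_le) fun U V hUV =>
      (h𝒞.2 U.2 V.2 (Subtype.coe_injective.ne hUV)).mono (hNU U) (hNU V)

end AssociatedGroup

section HullGroup

variable {G : Type u} [Group G] [TopologicalSpace G]

theorem exists_eventually_mk_eq (z : realHull G) (N : SmKernel G) :
    ∃ c : G ⧸ N.1, ∀ᶠ x : G in zeroSetFilter (z : StoneCech G), (x : G ⧸ N.1) = c := by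
  obtain ⟨N, H, _, _, _, _, _, p, hp, rfl⟩ := N
  have h := eventually_eq_hullExtend hp z
  obtain ⟨x₀, hx₀⟩ := h.exists
  exact ⟨x₀, h.mono fun x hx => QuotientGroup.eq.2 (p.eq_iff.1 (hx₀.trans hx.symm))⟩

/-- The coset of `N` that belongs to the zero set filter of `z`. -/
noncomputable def hullCoset (z : realHull G) (N : SmKernel G) : G ⧸ N.1 :=
  (exists_eventually_mk_eq z N).choose

theorem eventually_mk_eq_hullCoset (z : realHull G) (N : SmKernel G) :
    ∀ᶠ x : G in zeroSetFilter (z : StoneCech G), (x : G ⧸ N.1) = hullCoset z N :=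
  (exists_eventually_mk_eq z N).choose_spec

theorem exists_mk_eq_hullCoset (z : realHull G) (N : SmKernel G) :
    ∃ a : G, (a : G ⧸ N.1) = hullCoset z N :=
  (eventually_mk_eq_hullCoset z N).exists

theorem hullCoset_hullUnit (x : G) (N : SmKernel G) : hullCoset (hullUnit x) N = x :=
  (pure_le_zeroSetFilter x (eventually_mk_eq_hullCoset (hullUnit x) N)).symm

theorem hullExtend_eq_of_mk_eq_hullCoset {M : Type*} [TopologicalSpace M]
    [TopologicalSpace.MetrizableSpace M] [SecondCountableTopology M] {φ : G → M}
    (hφ : Continuous φ) {N : SmKernel G} (hN : ∀ x y, x⁻¹ * y ∈ N.1 → φ x = φ y)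
    {z : realHull G} {a : G} (ha : (a : G ⧸ N.1) = hullCoset z N) : hullExtend hφ z = φ a := by
  obtain ⟨x, hx, hx'⟩ :=
    ((eventually_eq_hullExtend hφ z).and (eventually_mk_eq_hullCoset z N)).exists
  exact hx.symm.trans (hN x a (QuotientGroup.eq.1 (hx'.trans ha.symm)))

theorem hullExtend_eq_kerLift_hullCoset {H : Type*} [Group H] [TopologicalSpace H]
    [TopologicalSpace.MetrizableSpace H] [SecondCountableTopology H] {p : G →* H}
    (hp : Continuous p) (hN : IsSmKernel p.ker) (z : realHull G) :
    hullExtend hp z = QuotientGroup.kerLift p (hullCoset z ⟨p.ker, hN⟩) := by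
  obtain ⟨a, ha⟩ := exists_mk_eq_hullCoset z ⟨p.ker, hN⟩
  rw [← ha, QuotientGroup.kerLift_mk]
  exact hullExtend_eq_of_mk_eq_hullCoset hp (fun x y hxy => (p.eq_iff.2 hxy).symm) ha

/-- The compatible families of cosets of the sm-kernels. Since the sm-kernels are closed under
finite intersections, this is the inverse limit of the corresponding quotients of `G`. -/
def kernelThreads (G : Type u) [Group G] [TopologicalSpace G] :
    Subgroup (∀ N : SmKernel G, G ⧸ N.1) where
  carrier := {c | ∀ N M, ∃ g : G, (g : G ⧸ N.1) = c N ∧ (g : G ⧸ M.1) = c M}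
  mul_mem' := fun {c d} hc hd N M => by
    obtain ⟨g, hgN, hgM⟩ := hc N M
    obtain ⟨k, hkN, hkM⟩ := hd N M
    exact ⟨g * k, by simp [hgN, hkN], by simp [hgM, hkM]⟩
  one_mem' := fun N M => ⟨1, rfl, rfl⟩
  inv_mem' := fun {c} hc N M => by
    obtain ⟨g, hgN, hgM⟩ := hc N M
    exact ⟨g⁻¹, by simp [hgN], by simp [hgM]⟩

theorem hullCoset_mem_kernelThreads (z : realHull G) : hullCoset z ∈ kernelThreads G :=
  fun N M => ((eventually_mk_eq_hullCoset z N).and (eventually_mk_eq_hullCoset z M)).exists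

theorem hullCoset_injective (hG : IsSimplySmFactorizable G) :
    Function.Injective (hullCoset : realHull G → _) := fun z w h => by
  refine injective_hullExtend_eval (funext fun f => ?_)
  obtain ⟨N, hfN⟩ := hG.exists_smKernel f.continuous
  obtain ⟨a, ha⟩ := exists_mk_eq_hullCoset z N
  exact (hullExtend_eq_of_mk_eq_hullCoset f.continuous hfN ha).trans
    (hullExtend_eq_of_mk_eq_hullCoset f.continuous hfN (ha.trans (congr_fun h _))).symm

theorem mk_eq_of_mem_kernelThreads {c : ∀ N : SmKernel G, G ⧸ N.1} (hc : c ∈ kernelThreads G)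
    {N M : SmKernel G} (hNM : N ≤ M) {x : G} (hx : (x : G ⧸ N.1) = c N) :
    (x : G ⧸ M.1) = c M := by
  obtain ⟨g, hgN, hgM⟩ := hc N M
  rw [← hgM]
  exact QuotientGroup.eq.2 (hNM (QuotientGroup.eq.1 (hx.trans hgN.symm)))

theorem iInf_principal_coset_neBot [Nonempty (SmKernel G)] {c : ∀ N : SmKernel G, G ⧸ N.1}
    (hc : c ∈ kernelThreads G) : (⨅ N : SmKernel G, 𝓟 {x : G | (x : G ⧸ N.1) = c N}).NeBot := by
  refine iInf_neBot_of_directed' (fun N M => ⟨⟨N.1 ⊓ M.1, N.2.inf M.2⟩, ?_, ?_⟩) fun N => ?_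
  · exact principal_mono.2 fun _ => mk_eq_of_mem_kernelThreads hc (inf_le_left : N.1 ⊓ M.1 ≤ N.1)
  · exact principal_mono.2 fun _ => mk_eq_of_mem_kernelThreads hc (inf_le_right : N.1 ⊓ M.1 ≤ M.1)
  · obtain ⟨g, hg, -⟩ := hc N N
    exact principal_neBot_iff.2 ⟨g, hg⟩

theorem exists_hullCoset_eq (hG : IsSimplySmFactorizable G) {c : ∀ N : SmKernel G, G ⧸ N.1}
    (hc : c ∈ kernelThreads G) : ∃ z : realHull G, hullCoset z = c := by
  let F : Filter G := ⨅ N : SmKernel G, 𝓟 {x : G | (x : G ⧸ N.1) = c N}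
  have mem_F : ∀ N : SmKernel G, ∀ᶠ x : G in F, (x : G ⧸ N.1) = c N := fun N =>
    mem_iInf_of_mem N (mem_principal_self _)
  have : Nonempty (SmKernel G) := (hG.exists_smKernel (f := 0) continuous_const).nonempty
  have hF : F.NeBot := iInf_principal_coset_neBot hc
  obtain ⟨z, hFz⟩ : ∃ z, F ≤ zeroSetFilter z := by
    refine exists_le_zeroSetFilter fun f hf => ?_
    obtain ⟨N, hfN⟩ := hG.exists_smKernel hf
    obtain ⟨a, ha, -⟩ := hc N N
    exact ⟨f a, (mem_F N).mono fun x hx =>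
      hfN x a (QuotientGroup.eq.1 (hx.trans ha.symm))⟩
  refine ⟨⟨z, neBot_of_le hFz⟩, funext fun N => ?_⟩
  obtain ⟨x, hx, hx'⟩ := ((mem_F N).and (hFz (eventually_mk_eq_hullCoset ⟨z, _⟩ N))).exists
  exact hx'.symm.trans hx

/-- The hull as the group of compatible families of cosets. -/
noncomputable def hullEquiv (hG : IsSimplySmFactorizable G) : realHull G ≃ kernelThreads G :=
  Equiv.ofBijective (fun z => ⟨hullCoset z, hullCoset_mem_kernelThreads z⟩)
    ⟨fun _ _ h => hullCoset_injective hG (congr_arg Subtype.val h), fun c =>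
      (exists_hullCoset_eq hG c.2).imp fun _ h => Subtype.ext h⟩

theorem exists_group_realHull (hG : IsSimplySmFactorizable G) :
    ∃ _ : Group (realHull G), ∀ (z w : realHull G) (N : SmKernel G),
      hullCoset (z * w) N = hullCoset z N * hullCoset w N := by
  let _ := (hullEquiv hG).group
  refine ⟨inferInstance, fun z w N => ?_⟩
  have h : hullEquiv hG (z * w) = hullEquiv hG z * hullEquiv hG w :=
    (hullEquiv hG).apply_symm_apply _
  exact congr_fun (congr_arg Subtype.val h) N

theorem exists_smKernel_eventually_mem [CompletelyRegularSpace G] [ContinuousMul G]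
    (hG : IsSimplySmFactorizable G) {V : Set G} (hV : V ∈ 𝓝 (1 : G)) :
    ∃ N : SmKernel G, ∀ (z₀ : realHull G) (a₀ : G), (a₀ : G ⧸ N.1) = hullCoset z₀ N →
      ∀ᶠ z in 𝓝 z₀, ∀ a : G, (a : G ⧸ N.1) = hullCoset z N → a₀⁻¹ * a ∈ V := by
  obtain ⟨g, hg, hg0, hg1⟩ := CompletelyRegularSpace.completely_regular_isOpen (1 : G) _
    isOpen_interior (mem_interior_iff_mem_nhds.2 hV)
  obtain ⟨N, hgN⟩ := hG.exists_smKernel (continuous_subtype_val.comp hg)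
  refine ⟨N, fun z₀ a₀ ha₀ => ?_⟩
  have hf : Continuous fun x => (g (a₀⁻¹ * x) : ℝ) :=
    continuous_subtype_val.comp (hg.comp (continuous_const_mul _))
  have hfN : ∀ x y, x⁻¹ * y ∈ N.1 → (g (a₀⁻¹ * x) : ℝ) = g (a₀⁻¹ * y) := fun x y hxy =>
    hgN _ _ (by rwa [mul_inv_rev, inv_inv, mul_assoc, mul_inv_cancel_left])
  have hz₀ : hullExtend hf z₀ ≠ 1 := by
    rw [hullExtend_eq_of_mk_eq_hullCoset hf hfN ha₀]
    simp [hg0]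
  filter_upwards [(continuous_hullExtend hf).continuousAt.eventually_ne hz₀] with z hz a ha
  by_contra haV
  refine hz ((hullExtend_eq_of_mk_eq_hullCoset hf hfN ha).trans ?_)
  exact congrArg Subtype.val (hg1 fun h => haV (interior_subset h))

variable [Group (realHull G)]
  (hmul : ∀ (z w : realHull G) (N : SmKernel G),
    hullCoset (z * w) N = hullCoset z N * hullCoset w N)
include hmul

theorem hullUnit_mul (hG : IsSimplySmFactorizable G) (x y : G) :
    (hullUnit (x * y) : realHull G) = hullUnit x * hullUnit y :=
  hullCoset_injective hG (funext fun N => by simp [hmul, hullCoset_hullUnit])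

theorem isSimplySmFactorizable_realHull (hG : IsSimplySmFactorizable G) :
    IsSimplySmFactorizable (realHull G) := by
  rw [isSimplySmFactorizable_iff]
  rintro _ ⟨u, hu, rfl⟩
  have hf : Continuous (u ∘ hullUnit) := hu.comp continuous_hullUnit
  obtain ⟨⟨_, H, _, _, _, _, _, p, hp, rfl⟩, hfN⟩ := hG.exists_smKernel hf
  let N : SmKernel G := ⟨p.ker, H, _, _, ‹_›, ‹_›, ‹_›, p, hp, rfl⟩
  let q : realHull G →* H :=
    (QuotientGroup.kerLift p).comp (MonoidHom.mk' (hullCoset · N) fun z w => hmul z w N)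
  have hq : Continuous q :=
    (continuous_hullExtend hp).congr (hullExtend_eq_kerLift_hullCoset hp N.2)
  refine ⟨q.ker, ⟨H, _, _, ‹_›, ‹_›, ‹_›, q, hq, rfl⟩, fun z w hzw hz hw => hz ?_⟩
  have hcoset : hullCoset w N = hullCoset z N :=
    QuotientGroup.kerLift_injective p (q.eq_iff.2 hzw)
  obtain ⟨a, ha⟩ := exists_mk_eq_hullCoset z N
  rw [← hw, eq_hullExtend hf hu fun _ => rfl, hullExtend_eq_of_mk_eq_hullCoset hf hfN ha,
    hullExtend_eq_of_mk_eq_hullCoset hf hfN (ha.trans hcoset.symm)]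

theorem hullExtend_mul {f : G → ℝ} (hf : Continuous f) {N : SmKernel G}
    (hN : ∀ x y, x⁻¹ * y ∈ N.1 → f x = f y) {z w : realHull G} {a b : G}
    (ha : (a : G ⧸ N.1) = hullCoset z N) (hb : (b : G ⧸ N.1) = hullCoset w N) :
    hullExtend hf (z * w) = f (a * b) :=
  hullExtend_eq_of_mk_eq_hullCoset hf hN (by rw [hmul, ← ha, ← hb, QuotientGroup.mk_mul])

theorem continuousMul_realHull [CompletelyRegularSpace G] [ContinuousMul G]
    (hG : IsSimplySmFactorizable G) : ContinuousMul (realHull G) := by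
  refine ⟨isClosedEmbedding_hullExtend_eval.isInducing.continuous_iff.2 (continuous_pi fun f =>
    continuous_iff_continuousAt.2 fun ⟨z₀, w₀⟩ => Metric.tendsto_nhds.2 fun ε hε => ?_)⟩
  obtain ⟨N, hfN⟩ := hG.exists_smKernel f.continuous
  obtain ⟨a₀, ha₀⟩ := exists_mk_eq_hullCoset z₀ N
  obtain ⟨b₀, hb₀⟩ := exists_mk_eq_hullCoset w₀ N
  have hf : ∀ᶠ v : G × G in 𝓝 1 ×ˢ 𝓝 1,
      dist (f (a₀ * v.1 * (b₀ * v.2))) (f (a₀ * b₀)) < ε := by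
    have : Continuous fun v : G × G => f (a₀ * v.1 * (b₀ * v.2)) := by fun_prop
    rw [← nhds_prod_eq]
    exact (this.tendsto' (1, 1) _ (by simp)).eventually (Metric.ball_mem_nhds _ hε)
  obtain ⟨V, hV, hVf⟩ := eventually_prod_self_iff'.1 hf
  obtain ⟨M, hM⟩ := exists_smKernel_eventually_mem hG hV
  obtain ⟨a₁, ha₁N, ha₁M⟩ := hullCoset_mem_kernelThreads z₀ N M
  obtain ⟨b₁, hb₁N, hb₁M⟩ := hullCoset_mem_kernelThreads w₀ N M
  filter_upwards [(hM z₀ a₁ ha₁M).prod_nhds (hM w₀ b₁ hb₁M)] with ⟨z, w⟩ ⟨hz, hw⟩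
  obtain ⟨a, haN, haM⟩ := hullCoset_mem_kernelThreads z N M
  obtain ⟨b, hbN, hbM⟩ := hullCoset_mem_kernelThreads w N M
  have ha : ((a₀ * (a₁⁻¹ * a) : G) : G ⧸ N.1) = hullCoset z N := by
    simp only [QuotientGroup.mk_mul, QuotientGroup.mk_inv, ha₀, ha₁N, haN, mul_inv_cancel_left]
  have hb : ((b₀ * (b₁⁻¹ * b) : G) : G ⧸ N.1) = hullCoset w N := by
    simp only [QuotientGroup.mk_mul, QuotientGroup.mk_inv, hb₀, hb₁N, hbN, mul_inv_cancel_left]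
  change dist (hullExtend f.continuous (z * w)) (hullExtend f.continuous (z₀ * w₀)) < ε
  rw [hullExtend_mul hmul f.continuous hfN ha hb, hullExtend_mul hmul f.continuous hfN ha₀ hb₀]
  exact hVf _ (hz a haM) _ (hw b hbM)

end HullGroup

theorem lemma4p4 (G : Type u) [Group G] [TopologicalSpace G] [ContinuousMul G] [T3Space G]
    (hG : IsSimplySmFactorizable G) :
    narrownessIndex (AssociatedGroup G) ≤ 𝔠 ∧
    cellularity G ≤ cellularity (AssociatedGroup G) ∧
    cellularity (AssociatedGroup G) ≤ 2 ^ (𝔠 : Cardinal.{u}) ∧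
    dieudonneCompletion G = hewittNachbin G ∧
    ∃ (_ : Group (dieudonneCompletion G)) (_ : ContinuousMul (dieudonneCompletion G))
      (j : G →* dieudonneCompletion G),
      (∀ g : G, (j g : StoneCech G) = stoneCechUnit g) ∧
      IsEmbedding j ∧ DenseRange j ∧
      IsSimplySmFactorizable (dieudonneCompletion G) := by
  have : T35Space G := t35Space_of_t3Space
  have hc : cellularity G ≤ 2 ^ (𝔠 : Cardinal.{u}) :=
    cellularity_le_cellularity_associatedGroup.trans hG.cellularity_associatedGroup_le
  have hX : IsNonmeasurable (cellularity G).out :=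
    isNonmeasurable_of_mk_le_two_power_continuum (by rwa [mk_out])
  refine ⟨hG.narrownessIndex_associatedGroup_le, cellularity_le_cellularity_associatedGroup,
    hG.cellularity_associatedGroup_le, ?_⟩
  rw [dieudonneCompletion_eq_realHull hX, hewittNachbin_eq_realHull]
  obtain ⟨_, hmul⟩ := exists_group_realHull hG
  exact ⟨rfl, inferInstance, continuousMul_realHull hmul hG,
    MonoidHom.mk' hullUnit (hullUnit_mul hmul hG), fun _ => rfl,
    IsEmbedding.of_comp continuous_hullUnit continuous_subtype_val isEmbedding_stoneCechUnit,
    denseRange_hullUnit, isSimplySmFactorizable_realHull hmul hG⟩
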